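/- Let $\mathbb{P}$ be a poset. A \emph{band} of $\mathbb{P}$ is a finite $B\subseteq\mathbb{P}$ such that every $p\in\mathbb{P}$ is comparable to some $b\in B$; a \emph{cap} is a set $C\subseteq\mathbb{P}$ for which there is a band $B$ such that every $b\in B$ lies below some $c\in C$; a \emph{selector} is a set $S\subseteq\mathbb{P}$ that meets every cap. The \emph{spectrum} $\mathsf{S}\mathbb{P}$ is the set of all minimal selectors (with respect to inclusion), with the topology that has the sets $p^\in=\{S\in\mathsf{S}\mathbb{P}:p\in S\}$, $p\in\mathbb{P}$, as a subbasis. Write $p\wedge q$ if $p$ and $q$ have a common lower bound in $\mathbb{P}$, and $p\vartriangleleft q$ if there is a cap $C$ such that every $c\in C$ with $c\wedge p$ satisfies $c\leq q$. Call $\mathbb{P}$ an \emph{$\omega$-poset} if every principal filter $\{q:q\geq p\}$ is finite and, for each $n\in\mathbb{N}$, only finitely many principal filters have exactly $n$ elements; \emph{regular} if for every cap $C$ there is a cap $D$ such that every $d\in D$ satisfies $d\vartriangleleft c$ for some $c\in C$; and \emph{prime} if $p^\in\neq\emptyset$ for every $p\in\mathbb{P}$. For posets $\mathbb{P}$ and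 $\mathbb{Q}$, a relation ${\sqsupset}\subseteq\mathbb{Q}\times\mathbb{P}$ is a \emph{refiner} if for every cap $D$ of $\mathbb{Q}$ there is a cap $C$ of $\mathbb{P}$ such that for every $c\in C$ there is $d\in D$ with $d\sqsupset c$; it is \emph{$\wedge$-preserving} if $q\sqsupset p$, $p\wedge p'$ and $q'\sqsupset p'$ imply $q\wedge q'$. Let $\mathbf{P}$ be the category whose objects are the regular prime $\omega$-posets and whose morphisms from $\mathbb{P}$ to $\mathbb{Q}$ are the $\wedge$-preserving refiners ${\sqsupset}\subseteq\mathbb{Q}\times\mathbb{P}$, with composition of relations as composition and equality relations as identities. Let $\mathbf{K}$ be the category of metrisable compact spaces and continuous maps. \textbf{Theorem.} For every object $\mathbb{P}$ of $\mathbf{P}$ the spectrum $\mathsf{S}\mathbb{P}$ is a metrisable compact space, and for every morphism ${\sqsupset}\subseteq\mathbb{Q}\times\mathbb{P}$ from $\mathbb{P}$ to $\mathbb{Q}$ in $\mathbf{P}$, \[\phi_\sqsupset(S)=S^{\sqsubset\vartriangleleft}=\{q\in\mathbb{Q}:\exists p\in S\ \exists q'\in\mathbb{Q}\ (q'\sqsupset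 p\text{ and }q'\vartriangleleft q)\}\] defines a continuous map $\phi_\sqsupset:\mathsf{S}\mathbb{P}\to\mathsf{S}\mathbb{Q}$. The assignments $\mathbb{P}\mapsto\mathsf{S}\mathbb{P}$ and ${\sqsupset}\mapsto\phi_\sqsupset$ define a functor $\mathsf{S}:\mathbf{P}\to\mathbf{K}$, and this functor is full and essentially surjective. -/

import Mathlib

open CategoryTheory

universe u

namespace PosetSpectrum

/-- `S^⊏ = {b | ∃ s ∈ S, s ⊏ b}` for a relation `⊏` between `A` and `B`. -/
def upImage {A B : Type u} (r : A → B → Prop) (S : Set A) : Set B :=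
  {b | ∃ s ∈ S, r s b}

/-- `S` refines `T` with respect to a relation `⊏`: every `s ∈ S` satisfies `s ⊏ t` for some
`t ∈ T`. -/
def Refines {A B : Type u} (r : A → B → Prop) (S : Set A) (T : Set B) : Prop :=
  ∀ s ∈ S, ∃ t ∈ T, r s t

section Poset

variable {P : Type u} [PartialOrder P]

/-- A band is a finite set such that every element of the poset is comparable to one of its
members. -/
def IsBand (B : Set P) : Prop :=
  B.Finite ∧ ∀ p : P, ∃ b ∈ B, b ≤ p ∨ p ≤ b

/-- A cap is a set refined by some band. -/
def IsCap (C : Set P) : Prop :=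
  ∃ B : Set P, IsBand B ∧ Refines (· ≤ ·) B C

/-- A selector is a set overlapping every cap. -/
def IsSelector (S : Set P) : Prop :=
  ∀ C : Set P, IsCap C → (S ∩ C).Nonempty

/-- `p ∧ q`: the elements `p` and `q` have a common lower bound. -/
def Wedge (p q : P) : Prop :=
  ∃ r : P, r ≤ p ∧ r ≤ q

/-- The star `Cp` of `p` in `C`. -/
def star (C : Set P) (p : P) : Set P :=
  {c ∈ C | Wedge p c}

/-- The star-below relation `p ◁ q`: for some cap `C`, every member of the star `Cp` is below
`q`. -/
def StarBelow (p q : P) : Prop :=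
  ∃ C : Set P, IsCap C ∧ ∀ c ∈ star C p, c ≤ q

variable (P)

/-- An `ω`-poset: principal filters are finite and, for every `n`, only finitely many of them have
size `n` (principal filters correspond bijectively to elements). -/
def IsOmegaPoset : Prop :=
  (∀ p : P, (Set.Ici p).Finite) ∧ ∀ n : ℕ, {p : P | (Set.Ici p).ncard = n}.Finite

/-- A regular poset: every cap is `◁`-refined by a cap. -/
def IsRegularPoset : Prop :=
  ∀ C : Set P, IsCap C → ∃ D : Set P, IsCap D ∧ Refines StarBelow D C

/-- The spectrum of a poset: the set of its minimal selectors. -/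
def Spectrum : Type u :=
  {S : Set P // Minimal IsSelector S}

/-- The topology of the spectrum has the sets `p^∈ = {S | p ∈ S}` as a subbasis. -/
instance : TopologicalSpace (Spectrum P) :=
  TopologicalSpace.generateFrom (Set.range fun p : P => {S : Spectrum P | p ∈ S.1})

/-- A prime poset: `p^∈` is non-empty for every `p`. -/
def IsPrimePoset : Prop :=
  ∀ p : P, ∃ S : Spectrum P, p ∈ S.1

end Poset

section Relation

variable {P Q : Type u} [PartialOrder P] [PartialOrder Q]

/-- A relation `⊐ ⊆ Q × P` is a refiner if every cap of `Q` is refined, with respect to the inverse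
relation `⊏`, by a cap of `P`. -/
def IsRefiner (r : Q → P → Prop) : Prop :=
  ∀ D : Set Q, IsCap D → ∃ C : Set P, IsCap C ∧ Refines (flip r) C D

/-- A relation `⊐ ⊆ Q × P` is `∧`-preserving if `q ⊐ p`, `p ∧ p'` and `q' ⊐ p'` imply
`q ∧ q'`. -/
def WedgePreserving (r : Q → P → Prop) : Prop :=
  ∀ (p p' : P) (q q' : Q), r q p → Wedge p p' → r q' p' → Wedge q q'

/-- The set `S^{⊏◁}`. -/
def starImage (r : Q → P → Prop) (S : Set P) : Set Q :=
  upImage StarBelow (upImage (flip r) S)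

end Relation

/-- The objects of the category `𝐏`: regular prime `ω`-posets. -/
structure PCat : Type (u + 1) where
  carrier : Type u
  [order : PartialOrder carrier]
  omega : IsOmegaPoset carrier
  regular : IsRegularPoset carrier
  prime : IsPrimePoset carrier

namespace PCat

instance : CoeSort PCat.{u} (Type u) := ⟨PCat.carrier⟩

instance (P : PCat.{u}) : PartialOrder P := P.order

/-- The morphisms from `P` to `Q` in `𝐏`: `∧`-preserving refiners `⊐ ⊆ Q × P`. -/
@[ext]
structure Hom (P Q : PCat.{u}) : Type u where
  rel : Q → P → Prop
  refiner : IsRefiner rel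
  wedge : WedgePreserving rel

/-- Identities are the equality relations; composition is composition of relations. -/
instance : Category PCat.{u} where
  Hom := Hom
  id P :=
    { rel := fun q p => q = p
      refiner := fun D hD => ⟨D, hD, fun d hd => ⟨d, hd, rfl⟩⟩
      wedge := by
        rintro p p' _ _ rfl h rfl
        exact h }
  comp {P Q R} f g :=
    { rel := fun r p => ∃ q : Q, g.rel r q ∧ f.rel q p
      refiner := fun E hE => by
        obtain ⟨D, hD, hDE⟩ := g.refiner E hE
        obtain ⟨C, hC, hCD⟩ := f.refiner D hD
        refine ⟨C, hC, fun c hc => ?_⟩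
        obtain ⟨d, hd, hcd⟩ := hCD c hc
        obtain ⟨e, he, hde⟩ := hDE d hd
        exact ⟨e, he, d, hde, hcd⟩
      wedge := by
        rintro p p' r r' ⟨q, hrq, hqp⟩ h ⟨q', hrq', hqp'⟩
        exact g.wedge q q' r r' hrq (f.wedge p p' q q' hqp h hqp') hrq' }
  id_comp f := by
    apply Hom.ext
    funext q p
    simp
  comp_id f := by
    apply Hom.ext
    funext q p
    simp
  assoc f g h := by
    apply Hom.ext
    funext s p
    apply propext
    constructor
    · rintro ⟨r, hr, q, hq, hp⟩
      exact ⟨q, ⟨r, hr, hq⟩, hp⟩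
    · rintro ⟨q, ⟨r, hr, hq⟩, hp⟩
      exact ⟨r, hr, q, hq, hp⟩

end PCat

/-- The category `𝐊` of metrisable compact spaces and continuous maps (the Hausdorff condition
built into `CompHausLike` follows from metrisability). -/
abbrev KCat : Type (u + 1) :=
  CompHausLike.{u} (fun X => TopologicalSpace.MetrizableSpace X)

/-- The spectrum of a poset as an object of `𝐊`, once it is known to be compact and metrisable. -/
def spectrumObj (P : PCat.{u})
    (h : CompactSpace (Spectrum P) ∧ TopologicalSpace.MetrizableSpace (Spectrum P)) : KCat.{u} :=
  haveI := h.1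
  haveI := h.2
  { toTop := TopCat.of (Spectrum P)
    is_compact := h.1
    is_hausdorff := inferInstanceAs (T2Space (Spectrum P))
    prop := h.2 }

/-- The map `φ_⊐ : S ↦ S^{⊏◁}` between spectra, once its values are known to be minimal
selectors. -/
def spectrumMap {P Q : PCat.{u}} (f : P ⟶ Q)
    (h : ∀ S : Spectrum P, Minimal IsSelector (starImage f.rel S.1)) :
    Spectrum P → Spectrum Q :=
  fun S => ⟨starImage f.rel S.1, h S⟩

/-- The functor `𝖲 : 𝐏 ⥤ 𝐊` with `P ↦ 𝖲P` and `⊐ ↦ φ_⊐`, assembled from the facts that say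
that these assignments do define a functor to `𝐊`. -/
def spectrumFunctor
    (hobj : ∀ P : PCat.{u},
      CompactSpace (Spectrum P) ∧ TopologicalSpace.MetrizableSpace (Spectrum P))
    (hsel : ∀ (P Q : PCat.{u}) (f : P ⟶ Q) (S : Spectrum P),
      Minimal IsSelector (starImage f.rel S.1))
    (hcont : ∀ (P Q : PCat.{u}) (f : P ⟶ Q), Continuous (spectrumMap f (hsel P Q f)))
    (hid : ∀ (P : PCat.{u}) (S : Spectrum P), spectrumMap (𝟙 P) (hsel P P (𝟙 P)) S = S)
    (hcomp : ∀ (P Q R : PCat.{u}) (f : P ⟶ Q) (g : Q ⟶ R) (S : Spectrum P),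
      spectrumMap (f ≫ g) (hsel P R (f ≫ g)) S =
        spectrumMap g (hsel Q R g) (spectrumMap f (hsel P Q f) S)) :
    PCat.{u} ⥤ KCat.{u} where
  obj P := spectrumObj P (hobj P)
  map {P Q} f :=
    ConcreteCategory.ofHom (C := KCat.{u}) (X := spectrumObj P (hobj P))
      (Y := spectrumObj Q (hobj Q))
      (⟨spectrumMap f (hsel P Q f), hcont P Q f⟩ : C(Spectrum P, Spectrum Q))
  map_id P := by
    ext S
    exact hid P S
  map_comp {P Q R} f g := by
    ext S
    exact hcomp P Q R f g S

end PosetSpectrum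

/-!
A set is a selector exactly if its complement is not a cap. As caps have finite subcaps, every
selector contains a minimal one, and the caps are the sets `C` for which the `c^∈`, `c ∈ C`, cover
the spectrum; hence the spectrum is compact.

Two selectors `S` and `T` are linked if `s ∧ t` for all `s ∈ S` and `t ∈ T`. In a regular prime
`ω`-poset `S^◁` is a minimal selector whenever `S` is linked to itself, and `S^◁ = T^◁` whenever `S`
and `T` are linked. Minimal selectors of an `ω`-poset are linked to themselves and `∧`-preserving
relations preserve linkedness, so `S^{⊏◁}` is a point of the target spectrum and composition is
preserved.

A continuous map `φ` of spectra is the image of the relation `p^∈ ⊆ φ⁻¹(q^∈)`. A metrisable compact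
space `X` has a sequence of finite open covers that is cofinal among all finite open covers. The
members of these covers, ordered by inclusion at increasing levels, form a poset whose caps are the
covers of `X`, so the minimal selectors are the sets of all members containing a given point.
-/

namespace PosetSpectrum

section Refines

variable {A : Type u} {r : A → A → Prop} {S T U : Set A}

theorem refines_of_subset [Std.Refl r] (h : S ⊆ T) : Refines r S T :=
  fun s hs => ⟨s, h hs, refl_of r s⟩

theorem Refines.refl [Std.Refl r] (S : Set A) : Refines r S S :=
  refines_of_subset subset_rfl

theorem Refines.trans [IsTrans A r] (hST : Refines r S T) (hTU : Refines r T U) :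
    Refines r S U := by
  intro s hs
  obtain ⟨t, ht, hst⟩ := hST s hs
  obtain ⟨u, hu, htu⟩ := hTU t ht
  exact ⟨u, hu, trans_of r hst htu⟩

end Refines

section Cap

variable {P : Type u} [PartialOrder P] {B C D F : Set P}

theorem IsBand.isCap (hB : IsBand B) : IsCap B :=
  ⟨B, hB, Refines.refl B⟩

theorem IsCap.of_refines (hC : IsCap C) (h : Refines (· ≤ ·) C D) : IsCap D :=
  let ⟨B, hB, hBC⟩ := hC
  ⟨B, hB, hBC.trans h⟩

theorem IsCap.mono (hC : IsCap C) (h : C ⊆ D) : IsCap D :=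
  hC.of_refines (refines_of_subset h)

theorem IsCap.exists_finite_subset (hC : IsCap C) : ∃ D ⊆ C, D.Finite ∧ IsCap D := by
  obtain ⟨B, hB, hBC⟩ := hC
  choose! f hfC hle using hBC
  exact ⟨f '' B, Set.image_subset_iff.2 hfC, hB.1.image f,
    hB.isCap.of_refines fun b hb => ⟨f b, Set.mem_image_of_mem f hb, hle b hb⟩⟩

/-- The minimal elements of `{p | Ioi p ⊆ F}`. For an upper set `F`, this is the first layer of the
poset lying below all of `F`: it consists of the minimal elements of `P` that belong to `F` and of
the maximal elements of the complement of `F`. -/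
def fringe (F : Set P) : Set P :=
  {p | Minimal (fun q => Set.Ioi q ⊆ F) p}

theorem mem_fringe {p : P} : p ∈ fringe F ↔ Minimal (fun q => Set.Ioi q ⊆ F) p :=
  Iff.rfl

theorem IsOmegaPoset.finite_setOf_Ioi_subset (h : IsOmegaPoset P) (hF : F.Finite) :
    {p | Set.Ioi p ⊆ F}.Finite := by
  refine ((Set.finite_Iic (F.ncard + 1)).biUnion fun n _ => h.2 n).subset fun p hp => ?_
  refine Set.mem_biUnion (x := (Set.Ici p).ncard) ?_ rfl
  have hIci : Set.Ici p ⊆ insert p F := fun q hpq =>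
    (eq_or_lt_of_le' hpq).imp_right fun hlt => hp hlt
  exact (Set.ncard_le_ncard hIci (hF.insert p)).trans (Set.ncard_insert_le p F)

theorem IsOmegaPoset.isBand_fringe (h : IsOmegaPoset P) (hF : F.Finite) (hup : IsUpperSet F) :
    IsBand (fringe F) := by
  have hfin := h.finite_setOf_Ioi_subset hF
  refine ⟨hfin.subset fun p hp => (mem_fringe.1 hp).prop, fun p => ?_⟩
  by_cases hp : p ∈ F
  · obtain ⟨b, hbp, hb⟩ := hfin.exists_le_minimal
      (show p ∈ {p | Set.Ioi p ⊆ F} from fun q hpq => hup hpq.le hp)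
    exact ⟨b, mem_fringe.2 hb, Or.inl hbp⟩
  · obtain ⟨q, hpq, hq⟩ := ((h.1 p).inter_of_left Fᶜ).exists_le_maximal ⟨le_rfl, hp⟩
    refine ⟨q, mem_fringe.2 ⟨fun r hqr => ?_, fun r hr hrq => ?_⟩, Or.inr hpq⟩
    · by_contra hrF
      exact hq.not_prop_of_gt hqr ⟨hpq.trans hqr.le, hrF⟩
    · exact (eq_or_lt_of_le hrq).elim Eq.ge fun hlt => absurd (hr hlt) hq.prop.2

theorem IsBand.fringe_refines (hB : IsBand B) (hBF : B ⊆ F) (hup : IsUpperSet F) :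
    Refines (· ≤ ·) (fringe F) B := by
  intro p hp
  obtain ⟨b, hb, hbp | hpb⟩ := hB.2 p
  · exact ⟨b, hb, (mem_fringe.1 hp).le_of_le (fun q hbq => hup hbq.le (hBF hb)) hbp⟩
  · exact ⟨b, hb, hpb⟩

theorem IsOmegaPoset.exists_isCap_refines (h : IsOmegaPoset P) (hC : IsCap C) (hD : IsCap D) :
    ∃ E : Set P, IsCap E ∧ Refines (· ≤ ·) E C ∧ Refines (· ≤ ·) E D := by
  obtain ⟨A, hA, hAC⟩ := hC
  obtain ⟨B, hB, hBD⟩ := hD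
  let F : UpperSet P := upperClosure (A ∪ B)
  have hF : (F : Set P).Finite := by
    rw [coe_upperClosure]
    exact (hA.1.union hB.1).biUnion fun p _ => h.1 p
  have hABF : A ∪ B ⊆ F := subset_upperClosure
  have hAF := hA.fringe_refines (Set.subset_union_left.trans hABF) F.upper
  have hBF := hB.fringe_refines (Set.subset_union_right.trans hABF) F.upper
  exact ⟨fringe F, (h.isBand_fringe hF F.upper).isCap,
    hAF.trans hAC, hBF.trans hBD⟩

theorem IsOmegaPoset.countable (h : IsOmegaPoset P) : Countable P :=
  Set.countable_univ_iff.1 <| (Set.countable_iUnion fun n => (h.2 n).countable).mono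
    fun p _ => Set.mem_iUnion.2 ⟨(Set.Ici p).ncard, rfl⟩

end Cap

section Selector

variable {P : Type u} [PartialOrder P] {C S : Set P} {p q r : P}

theorem isSelector_iff_not_isCap_compl : IsSelector S ↔ ¬ IsCap Sᶜ := by
  refine ⟨fun hS hC => ?_, fun h C hC => ?_⟩
  · obtain ⟨p, hp, hp'⟩ := hS _ hC
    exact hp' hp
  · by_contra hSC
    exact h (hC.mono fun c hc hcS => hSC ⟨c, hcS, hc⟩)

theorem isOfFiniteCharacter_not_isCap : Order.IsOfFiniteCharacter {C : Set P | ¬ IsCap C} := by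
  refine fun C => ⟨fun hC D hDC _ hD => hC (hD.mono hDC), fun h hC => ?_⟩
  obtain ⟨D, hDC, hfin, hD⟩ := hC.exists_finite_subset
  exact h D hDC hfin hD

theorem IsSelector.exists_minimal_subset (hS : IsSelector S) :
    ∃ T ⊆ S, Minimal IsSelector T := by
  obtain ⟨M, hSM, hM⟩ :=
    isOfFiniteCharacter_not_isCap.exists_maximal (isSelector_iff_not_isCap_compl.1 hS)
  refine ⟨Mᶜ, Set.compl_subset_comm.1 hSM, ?_, fun T hT hTM => ?_⟩
  · rw [isSelector_iff_not_isCap_compl, compl_compl]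
    exact hM.prop
  · exact Set.compl_subset_comm.1 <|
      hM.le_of_ge (isSelector_iff_not_isCap_compl.1 hT) (Set.subset_compl_comm.1 hTM)

theorem isCap_iff_forall_spectrum : IsCap C ↔ ∀ S : Spectrum P, (S.1 ∩ C).Nonempty := by
  refine ⟨fun hC S => S.2.prop C hC, fun h => ?_⟩
  by_contra hC
  have hsel : IsSelector Cᶜ := isSelector_iff_not_isCap_compl.2 (by rwa [compl_compl])
  obtain ⟨T, hTC, hT⟩ := hsel.exists_minimal_subset
  obtain ⟨p, hpT, hpC⟩ := h ⟨T, hT⟩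
  exact hTC hpT hpC

theorem IsSelector.exists_le_of_starBelow (hS : IsSelector S) (hpq : StarBelow p q)
    (hp : ∀ s ∈ S, Wedge p s) : ∃ s ∈ S, s ≤ q := by
  obtain ⟨C, hC, hCq⟩ := hpq
  obtain ⟨c, hcS, hc⟩ := hS C hC
  exact ⟨c, hcS, hCq c ⟨hc, hp c hcS⟩⟩

theorem StarBelow.trans_le (hpq : StarBelow p q) (hqr : q ≤ r) : StarBelow p r :=
  let ⟨C, hC, hCq⟩ := hpq
  ⟨C, hC, fun c hc => (hCq c hc).trans hqr⟩

namespace Spectrum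

variable (S : Spectrum P)

theorem mem_iff_isCap_insert_compl : p ∈ S.1 ↔ IsCap (insert p S.1ᶜ) := by
  refine ⟨fun hp => ?_, fun hC => ?_⟩
  · by_contra hC
    have hsel : IsSelector (S.1 \ {p}) := by
      rwa [isSelector_iff_not_isCap_compl, Set.compl_sdiff, Set.singleton_union]
    exact (S.2.le_of_le hsel Set.sdiff_subset hp).2 rfl
  · obtain ⟨q, hq, rfl | hq'⟩ := S.2.prop _ hC
    · exact hq
    · exact absurd hq hq'

theorem isUpperSet : IsUpperSet S.1 := fun p q hpq hp => by
  rw [mem_iff_isCap_insert_compl] at hp ⊢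
  refine hp.of_refines ?_
  rintro c (rfl | hc)
  · exact ⟨q, Set.mem_insert _ _, hpq⟩
  · exact ⟨c, Set.mem_insert_of_mem _ hc, le_rfl⟩

theorem eq_of_subset {S T : Spectrum P} (h : S.1 ⊆ T.1) : S = T :=
  Subtype.ext (T.2.eq_of_subset S.2.prop h)

theorem directedOn (h : IsOmegaPoset P) : DirectedOn (· ≥ ·) S.1 := by
  intro p hp q hq
  obtain ⟨E, hE, hEp, hEq⟩ := h.exists_isCap_refines
    (S.mem_iff_isCap_insert_compl.1 hp) (S.mem_iff_isCap_insert_compl.1 hq)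
  obtain ⟨e, heS, he⟩ := S.2.prop E hE
  have hle : ∀ x, Refines (· ≤ ·) E (insert x S.1ᶜ) → e ≤ x := by
    intro x hx
    obtain ⟨c, rfl | hc, hec⟩ := hx e he
    · exact hec
    · exact absurd (S.isUpperSet hec heS) hc
  exact ⟨e, heS, hle p hEp, hle q hEq⟩

theorem nonempty (h : IsOmegaPoset P) : S.1.Nonempty :=
  (S.2.prop _ (h.isBand_fringe Set.finite_empty isUpperSet_empty).isCap).left

end Spectrum

end Selector

section Linked

variable {P : Type u} [PartialOrder P] {S T : Set P} {p q r : P}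

/-- Two subsets of a poset are linked if `s ∧ t` for all `s ∈ S` and `t ∈ T`. For selectors this
notion controls when `S^◁` is minimal and when `S^◁ = T^◁`. -/
def Linked (S T : Set P) : Prop :=
  ∀ s ∈ S, ∀ t ∈ T, Wedge s t

theorem Spectrum.linked (S : Spectrum P) (h : IsOmegaPoset P) : Linked S.1 S.1 := by
  intro p hp q hq
  obtain ⟨r, -, hrp, hrq⟩ := S.directedOn h p hp q hq
  exact ⟨r, hrp, hrq⟩

theorem Spectrum.mem_of_starBelow (S : Spectrum P) (h : IsOmegaPoset P) (hpq : StarBelow p q)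
    (hp : p ∈ S.1) : q ∈ S.1 := by
  obtain ⟨s, hs, hsq⟩ := S.2.prop.exists_le_of_starBelow hpq (S.linked h p hp)
  exact S.isUpperSet hsq hs

theorem Spectrum.exists_starBelow (S : Spectrum P) (ho : IsOmegaPoset P) (hr : IsRegularPoset P)
    (hp : p ∈ S.1) : ∃ q ∈ S.1, StarBelow q p := by
  obtain ⟨D, hD, hDp⟩ := hr _ (S.mem_iff_isCap_insert_compl.1 hp)
  obtain ⟨d, hdS, hd⟩ := S.2.prop D hD
  obtain ⟨c, rfl | hc, hdc⟩ := hDp d hd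
  · exact ⟨d, hdS, hdc⟩
  · exact absurd (S.mem_of_starBelow ho hdc hdS) hc

theorem IsPrimePoset.exists_mem_mem (h : IsPrimePoset P) (hpq : Wedge p q) :
    ∃ S : Spectrum P, p ∈ S.1 ∧ q ∈ S.1 := by
  obtain ⟨r, hrp, hrq⟩ := hpq
  obtain ⟨S, hS⟩ := h r
  exact ⟨S, S.isUpperSet hrp hS, S.isUpperSet hrq hS⟩

theorem Wedge.trans_starBelow (ho : IsOmegaPoset P) (hp : IsPrimePoset P) (hpq : Wedge p q)
    (hqr : StarBelow q r) : Wedge p r := by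
  obtain ⟨S, hpS, hqS⟩ := hp.exists_mem_mem hpq
  exact S.linked ho p hpS r (S.mem_of_starBelow ho hqr hqS)

theorem Linked.upImage_starBelow (ho : IsOmegaPoset P) (hp : IsPrimePoset P) (h : Linked S T) :
    Linked S (upImage StarBelow T) := by
  rintro s hs q ⟨t, ht, htq⟩
  exact (h s hs t ht).trans_starBelow ho hp htq

theorem IsRegularPoset.isSelector_upImage_starBelow (h : IsRegularPoset P) (hS : IsSelector S) :
    IsSelector (upImage StarBelow S) := by
  intro D hD
  obtain ⟨E, hE, hED⟩ := h D hD
  obtain ⟨e, heS, he⟩ := hS E hE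
  obtain ⟨d, hd, hed⟩ := hED e he
  exact ⟨d, ⟨e, heS, hed⟩, hd⟩

/-- Linkedness is what makes `S^◁` minimal: if `s ◁ q` with `s ∈ S`, then every selector contained
in `S^◁` is linked to `s` and hence has a member below `q`. -/
theorem IsSelector.minimal_upImage_starBelow (ho : IsOmegaPoset P) (hr : IsRegularPoset P)
    (hp : IsPrimePoset P) (hS : IsSelector S) (hl : Linked S S) :
    Minimal IsSelector (upImage StarBelow S) := by
  refine ⟨hr.isSelector_upImage_starBelow hS, ?_⟩
  rintro M hM hMS q ⟨s, hs, hsq⟩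
  obtain ⟨N, hNM, hN⟩ := hM.exists_minimal_subset
  obtain ⟨n, hn, hnq⟩ := hN.prop.exists_le_of_starBelow hsq fun n hn =>
    hl.upImage_starBelow ho hp s hs n (hMS (hNM hn))
  exact hNM (Spectrum.isUpperSet ⟨N, hN⟩ hnq hn)

theorem Linked.upImage_starBelow_subset (ho : IsOmegaPoset P) (hr : IsRegularPoset P)
    (hp : IsPrimePoset P) (hT : IsSelector T) (h : Linked S T) :
    upImage StarBelow S ⊆ upImage StarBelow T := by
  rintro q ⟨s, hs, hsq⟩
  obtain ⟨t', ⟨t, ht, htt'⟩, ht'q⟩ :=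
    (hr.isSelector_upImage_starBelow hT).exists_le_of_starBelow hsq
      (h.upImage_starBelow ho hp s hs)
  exact ⟨t, ht, htt'.trans_le ht'q⟩

end Linked

section Topology

variable {P : Type u} [PartialOrder P]

/-- The subbasic open set `p^∈` of the spectrum. -/
def basicOpen (p : P) : Set (Spectrum P) :=
  {S | p ∈ S.1}

theorem isOpen_basicOpen (p : P) : IsOpen (basicOpen p) :=
  TopologicalSpace.isOpen_generateFrom_of_mem ⟨p, rfl⟩

theorem isTopologicalBasis_range_basicOpen (h : IsOmegaPoset P) :
    TopologicalSpace.IsTopologicalBasis (Set.range (basicOpen (P := P))) where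
  exists_subset_inter := by
    rintro _ ⟨p, rfl⟩ _ ⟨q, rfl⟩ S ⟨hp, hq⟩
    obtain ⟨r, hr, hrp, hrq⟩ := S.directedOn h p hp q hq
    exact ⟨basicOpen r, ⟨r, rfl⟩, hr, fun T hT => ⟨T.isUpperSet hrp hT, T.isUpperSet hrq hT⟩⟩
  sUnion_eq := Set.eq_univ_of_forall fun S =>
    let ⟨p, hp⟩ := S.nonempty h
    ⟨basicOpen p, ⟨p, rfl⟩, hp⟩
  eq_generateFrom := rfl

instance : CompactSpace (Spectrum P) := by
  refine compactSpace_generateFrom rfl fun 𝒰 h𝒰 hcov => ?_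
  have hC : IsCap {p : P | basicOpen p ∈ 𝒰} := by
    rw [isCap_iff_forall_spectrum]
    intro S
    obtain ⟨U, hU, hSU⟩ : S ∈ ⋃₀ 𝒰 := hcov ▸ Set.mem_univ S
    obtain ⟨p, rfl⟩ := h𝒰 hU
    exact ⟨p, hSU, hU⟩
  obtain ⟨D, hDC, hfin, hD⟩ := hC.exists_finite_subset
  refine ⟨basicOpen '' D, Set.image_subset_iff.2 hDC, hfin.image _,
    Set.eq_univ_of_forall fun S => ?_⟩
  obtain ⟨d, hdS, hd⟩ := S.2.prop D hD
  exact ⟨basicOpen d, Set.mem_image_of_mem _ hd, hdS⟩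

/-- If `q ◁ p` with `q ∈ S` and `p ∉ T`, then `q` cannot be linked to all of `T`, so `q^∈` is
disjoint from `t^∈` for some `t ∈ T`. -/
theorem t2Space_spectrum (ho : IsOmegaPoset P) (hr : IsRegularPoset P) :
    T2Space (Spectrum P) := by
  refine ⟨fun S T hST => ?_⟩
  obtain ⟨p, hpS, hpT⟩ : ∃ p ∈ S.1, p ∉ T.1 :=
    Set.not_subset.1 fun hsub => hST (Spectrum.eq_of_subset hsub)
  obtain ⟨q, hqS, hqp⟩ := S.exists_starBelow ho hr hpS
  obtain ⟨t, htT, hqt⟩ : ∃ t ∈ T.1, ¬ Wedge q t := by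
    by_contra! hq
    obtain ⟨t, htT, htp⟩ := T.2.prop.exists_le_of_starBelow hqp hq
    exact hpT (T.isUpperSet htp htT)
  exact ⟨basicOpen q, basicOpen t, isOpen_basicOpen q, isOpen_basicOpen t, hqS, htT,
    Set.disjoint_left.2 fun U hqU htU => hqt (U.linked ho q hqU t htU)⟩

theorem metrizableSpace_spectrum (ho : IsOmegaPoset P) (hr : IsRegularPoset P) :
    TopologicalSpace.MetrizableSpace (Spectrum P) := by
  have := t2Space_spectrum ho hr
  have := ho.countable
  have := (isTopologicalBasis_range_basicOpen ho).secondCountableTopology (Set.countable_range _)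
  exact TopologicalSpace.metrizableSpace_of_t3_secondCountable _

end Topology

section Morphism

variable {P Q : Type u} [PartialOrder P] [PartialOrder Q] {r : Q → P → Prop}

theorem IsRefiner.isSelector_upImage (hr : IsRefiner r) {S : Set P} (hS : IsSelector S) :
    IsSelector (upImage (flip r) S) := by
  intro D hD
  obtain ⟨C, hC, hCD⟩ := hr D hD
  obtain ⟨c, hcS, hc⟩ := hS C hC
  obtain ⟨d, hd, hcd⟩ := hCD c hc
  exact ⟨d, ⟨c, hcS, hcd⟩, hd⟩

theorem Linked.upImage_flip {S T : Set P} (h : Linked S T) (hr : WedgePreserving r) :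
    Linked (upImage (flip r) S) (upImage (flip r) T) := by
  rintro q ⟨s, hs, hqs⟩ q' ⟨t, ht, hqt⟩
  exact hr s t q q' hqs (h s hs t ht) hqt

theorem minimal_starImage (hP : IsOmegaPoset P) (hoQ : IsOmegaPoset Q) (hrQ : IsRegularPoset Q)
    (hpQ : IsPrimePoset Q) (href : IsRefiner r) (hwedge : WedgePreserving r) (S : Spectrum P) :
    Minimal IsSelector (starImage r S.1) :=
  (href.isSelector_upImage S.2.prop).minimal_upImage_starBelow hoQ hrQ hpQ
    ((S.linked hP).upImage_flip hwedge)

/-- The relation `p^∈ ⊆ φ⁻¹(q^∈)` between elements `q` of `Q` and `p` of `P` induced by a map `φ`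
of spectra. For continuous `φ` it is the morphism of `𝐏` witnessing fullness of `𝖲` at `φ`. -/
def inducedRel (φ : Spectrum P → Spectrum Q) (q : Q) (p : P) : Prop :=
  basicOpen p ⊆ φ ⁻¹' basicOpen q

variable {φ : Spectrum P → Spectrum Q}

theorem isRefiner_inducedRel (h : IsOmegaPoset P) (hφ : Continuous φ) :
    IsRefiner (inducedRel φ) := by
  refine fun D hD => ⟨{p | ∃ d ∈ D, inducedRel φ d p}, ?_, fun p hp => hp⟩
  rw [isCap_iff_forall_spectrum]
  intro S
  obtain ⟨d, hdS, hd⟩ := (φ S).2.prop D hD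
  obtain ⟨_, ⟨p, rfl⟩, hp, hpd⟩ := (isTopologicalBasis_range_basicOpen h).exists_subset_of_mem_open
    (show S ∈ φ ⁻¹' basicOpen d from hdS) ((isOpen_basicOpen d).preimage hφ)
  exact ⟨p, hp, d, hd, hpd⟩

theorem wedgePreserving_inducedRel (hP : IsPrimePoset P) (hQ : IsOmegaPoset Q) :
    WedgePreserving (inducedRel φ) := by
  intro p p' q q' hqp hpp' hqp'
  obtain ⟨S, hpS, hpS'⟩ := hP.exists_mem_mem hpp'
  exact (φ S).linked hQ q (hqp hpS) q' (hqp' hpS')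

theorem starImage_inducedRel_subset (hQ : IsOmegaPoset Q) (S : Spectrum P) :
    starImage (inducedRel φ) S.1 ⊆ (φ S).1 := by
  rintro q ⟨q', ⟨p, hp, hqp⟩, hq⟩
  exact (φ S).mem_of_starBelow hQ hq (hqp hp)

end Morphism

section Functor

variable {P Q R : PCat.{u}}

theorem PCat.Hom.minimal_starImage (f : P ⟶ Q) (S : Spectrum P) :
    Minimal IsSelector (starImage f.rel S.1) :=
  PosetSpectrum.minimal_starImage P.omega Q.omega Q.regular Q.prime f.refiner f.wedge S

theorem preimage_spectrumMap_basicOpen (f : P ⟶ Q) (q : Q) :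
    spectrumMap f f.minimal_starImage ⁻¹' basicOpen q =
      ⋃ (p : P) (_ : ∃ q', f.rel q' p ∧ StarBelow q' q), basicOpen p := by
  ext S
  simp only [Set.mem_iUnion]
  constructor
  · rintro ⟨q', ⟨p, hp, hqp⟩, hq⟩
    exact ⟨p, ⟨q', hqp, hq⟩, hp⟩
  · rintro ⟨p, ⟨q', hqp, hq⟩, hp⟩
    exact ⟨q', ⟨p, hp, hqp⟩, hq⟩

theorem continuous_spectrumMap (f : P ⟶ Q) : Continuous (spectrumMap f f.minimal_starImage) := by
  refine continuous_generateFrom_iff.2 (Set.forall_mem_range.2 fun q => ?_)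
  rw [← basicOpen, preimage_spectrumMap_basicOpen f q]
  exact isOpen_iUnion fun p => isOpen_iUnion fun _ => isOpen_basicOpen p

theorem spectrumMap_id (S : Spectrum P) :
    spectrumMap (𝟙 P) (𝟙 P : P ⟶ P).minimal_starImage S = S := by
  refine Spectrum.eq_of_subset ?_
  rintro q ⟨_, ⟨p, hp, rfl⟩, hq⟩
  exact S.mem_of_starBelow P.omega hq hp

theorem upImage_comp_rel (f : P ⟶ Q) (g : Q ⟶ R) (S : Set P) :
    upImage (flip (f ≫ g).rel) S = upImage (flip g.rel) (upImage (flip f.rel) S) := by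
  ext r
  constructor
  · rintro ⟨p, hp, q, hrq, hqp⟩
    exact ⟨q, ⟨p, hp, hqp⟩, hrq⟩
  · rintro ⟨q, ⟨p, hp, hqp⟩, hrq⟩
    exact ⟨p, hp, q, hrq, hqp⟩

/-- With `T = S^⊏` for `f`, the selectors `T` and `T^◁` are linked, hence so are their images under
`g`, and linked selectors have the same image under `◁`. -/
theorem spectrumMap_comp (f : P ⟶ Q) (g : Q ⟶ R) (S : Spectrum P) :
    spectrumMap (f ≫ g) (f ≫ g).minimal_starImage S =
      spectrumMap g g.minimal_starImage (spectrumMap f f.minimal_starImage S) := by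
  refine Spectrum.eq_of_subset ?_
  have hlinked : Linked (upImage (flip f.rel) S.1) (starImage f.rel S.1) :=
    ((S.linked P.omega).upImage_flip f.wedge).upImage_starBelow Q.omega Q.prime
  change upImage StarBelow (upImage (flip (f ≫ g).rel) S.1) ⊆ _
  rw [upImage_comp_rel]
  exact (hlinked.upImage_flip g.wedge).upImage_starBelow_subset R.omega R.regular R.prime
    (g.refiner.isSelector_upImage (f.minimal_starImage S).prop)

/-- A preimage of a continuous map of spectra under `𝖲`. -/
def homOfContinuous (φ : C(Spectrum P, Spectrum Q)) : P ⟶ Q where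
  rel := inducedRel φ
  refiner := isRefiner_inducedRel P.omega φ.continuous
  wedge := wedgePreserving_inducedRel P.prime Q.omega

theorem spectrumMap_homOfContinuous (φ : C(Spectrum P, Spectrum Q)) (S : Spectrum P) :
    spectrumMap (homOfContinuous φ) (homOfContinuous φ).minimal_starImage S = φ S :=
  Spectrum.eq_of_subset (starImage_inducedRel_subset Q.omega S)

end Functor

section Cover

variable {X : Type u} {𝒰 𝒱 : Set (Set X)}

/-- The cover by the non-empty intersections of a member of `𝒰` with a member of `𝒱`. -/
def commonRefinement (𝒰 𝒱 : Set (Set X)) : Set (Set X) :=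
  Set.image2 (· ∩ ·) 𝒰 𝒱 ∩ {W | W.Nonempty}

theorem commonRefinement_refines_left : Refines (· ⊆ ·) (commonRefinement 𝒰 𝒱) 𝒰 := by
  rintro _ ⟨⟨U, hU, V, -, rfl⟩, -⟩
  exact ⟨U, hU, Set.inter_subset_left⟩

theorem commonRefinement_refines_right : Refines (· ⊆ ·) (commonRefinement 𝒰 𝒱) 𝒱 := by
  rintro _ ⟨⟨U, -, V, hV, rfl⟩, -⟩
  exact ⟨V, hV, Set.inter_subset_right⟩

variable [TopologicalSpace X]

/-- A finite cover of a topological space by open sets. -/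
structure IsFiniteOpenCover (𝒰 : Set (Set X)) : Prop where
  finite : 𝒰.Finite
  isOpen : ∀ U ∈ 𝒰, IsOpen U
  exists_mem : ∀ x, ∃ U ∈ 𝒰, x ∈ U

theorem exists_isFiniteOpenCover_image [CompactSpace X] {ι : Type*} {I : Set ι} {U : ι → Set X}
    (hopen : ∀ i ∈ I, IsOpen (U i)) (hcov : ∀ x, ∃ i ∈ I, x ∈ U i) :
    ∃ J ⊆ I, J.Finite ∧ IsFiniteOpenCover (U '' J) := by
  obtain ⟨J, hJI, hJ, huniv⟩ := isCompact_univ.elim_finite_subcover_image hopen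
    fun x _ => Set.mem_iUnion₂.2 <| by simpa only [exists_prop] using hcov x
  refine ⟨J, hJI, hJ, hJ.image U, Set.forall_mem_image.2 fun i hi => hopen i (hJI hi),
    fun x => ?_⟩
  obtain ⟨i, hi, hx⟩ := Set.mem_iUnion₂.1 (huniv (Set.mem_univ x))
  exact ⟨U i, Set.mem_image_of_mem U hi, hx⟩

theorem isFiniteOpenCover_pair_compl_singleton [T1Space X] {U : Set X} (hU : IsOpen U) {x : X}
    (hx : x ∈ U) : IsFiniteOpenCover {U, {x}ᶜ} where
  finite := Set.toFinite _
  isOpen := by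
    rintro V (rfl | rfl)
    · exact hU
    · exact isOpen_compl_singleton
  exists_mem y := by
    by_cases hyx : y = x
    · exact ⟨U, Or.inl rfl, hyx ▸ hx⟩
    · exact ⟨{x}ᶜ, Or.inr rfl, hyx⟩

theorem isFiniteOpenCover_singleton_univ : IsFiniteOpenCover {(Set.univ : Set X)} where
  finite := Set.finite_singleton _
  isOpen _ hU := hU ▸ isOpen_univ
  exists_mem x := ⟨Set.univ, rfl, Set.mem_univ x⟩

theorem IsFiniteOpenCover.exists_refines_of_isTopologicalBasis [CompactSpace X] {𝓑 : Set (Set X)}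
    (h𝓑 : TopologicalSpace.IsTopologicalBasis 𝓑) (h𝒰 : IsFiniteOpenCover 𝒰) :
    ∃ 𝒱 ⊆ 𝓑, IsFiniteOpenCover 𝒱 ∧ Refines (· ⊆ ·) 𝒱 𝒰 := by
  obtain ⟨𝒱, h𝒱, -, hcover⟩ := exists_isFiniteOpenCover_image (U := id)
    (I := {V ∈ 𝓑 | ∃ U ∈ 𝒰, V ⊆ U}) (fun V hV => h𝓑.isOpen hV.1) fun x => by
      obtain ⟨U, hU, hx⟩ := h𝒰.exists_mem x
      obtain ⟨V, hV, hxV, hVU⟩ := h𝓑.exists_subset_of_mem_open hx (h𝒰.isOpen U hU)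
      exact ⟨V, ⟨hV, U, hU, hVU⟩, hxV⟩
  rw [Set.image_id] at hcover
  exact ⟨𝒱, fun V hV => (h𝒱 hV).1, hcover, fun V hV => (h𝒱 hV).2⟩

theorem exists_seq_isFiniteOpenCover_cofinal (X : Type u) [TopologicalSpace X] [CompactSpace X]
    [SecondCountableTopology X] :
    ∃ 𝒲 : ℕ → Set (Set X), (∀ n, IsFiniteOpenCover (𝒲 n)) ∧
      ∀ 𝒰, IsFiniteOpenCover 𝒰 → ∃ n, Refines (· ⊆ ·) (𝒲 n) 𝒰 := by
  let basicCovers : Set (Set (Set X)) :=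
    {𝒲 | 𝒲 ⊆ TopologicalSpace.countableBasis X ∧ IsFiniteOpenCover 𝒲}
  have hcofinal : ∀ 𝒰, IsFiniteOpenCover 𝒰 → ∃ 𝒲 ∈ basicCovers, Refines (· ⊆ ·) 𝒲 𝒰 := by
    intro 𝒰 h𝒰
    obtain ⟨𝒲, hbasic, h𝒲, href⟩ := h𝒰.exists_refines_of_isTopologicalBasis
      (TopologicalSpace.isBasis_countableBasis X)
    exact ⟨𝒲, ⟨hbasic, h𝒲⟩, href⟩
  have hcountable : basicCovers.Countable :=
    (Set.countable_ofPred_finite_subset (TopologicalSpace.countable_countableBasis X)).mono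
      fun 𝒲 h𝒲 => And.intro h𝒲.2.finite h𝒲.1
  have hnonempty : basicCovers.Nonempty :=
    let ⟨𝒲, h𝒲, _⟩ := hcofinal _ isFiniteOpenCover_singleton_univ
    ⟨𝒲, h𝒲⟩
  obtain ⟨𝒲, hrange⟩ := hcountable.exists_eq_range hnonempty
  refine ⟨𝒲, fun n => ?_, fun 𝒰 h𝒰 => ?_⟩
  · have hmem : 𝒲 n ∈ basicCovers := hrange ▸ Set.mem_range_self n
    exact hmem.2
  · exact Set.exists_range_iff.1 (hrange ▸ hcofinal 𝒰 h𝒰)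

theorem IsFiniteOpenCover.commonRefinement (h𝒰 : IsFiniteOpenCover 𝒰)
    (h𝒱 : IsFiniteOpenCover 𝒱) : IsFiniteOpenCover (commonRefinement 𝒰 𝒱) where
  finite := (h𝒰.finite.image2 _ h𝒱.finite).inter_of_left _
  isOpen := by
    rintro _ ⟨⟨U, hU, V, hV, rfl⟩, -⟩
    exact (h𝒰.isOpen U hU).inter (h𝒱.isOpen V hV)
  exists_mem x := by
    obtain ⟨U, hU, hxU⟩ := h𝒰.exists_mem x
    obtain ⟨V, hV, hxV⟩ := h𝒱.exists_mem x
    exact ⟨U ∩ V, ⟨⟨U, hU, V, hV, rfl⟩, x, hxU, hxV⟩, hxU, hxV⟩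

theorem refines_commonRefinement (h𝒰 : ∀ U ∈ 𝒰, U.Nonempty) (h𝒱 : IsFiniteOpenCover 𝒱) :
    Refines (· ⊇ ·) 𝒰 (commonRefinement 𝒰 𝒱) := by
  intro U hU
  obtain ⟨x, hxU⟩ := h𝒰 U hU
  obtain ⟨V, hV, hxV⟩ := h𝒱.exists_mem x
  exact ⟨U ∩ V, ⟨⟨U, hU, V, hV, rfl⟩, x, hxU, hxV⟩, Set.inter_subset_left⟩

/-- A sequence of finite covers by non-empty open sets that is cofinal among the finite open covers,
in which every cover refines its predecessor and every member of a cover contains a member of the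
next one. -/
structure CoverSeq (X : Type u) [TopologicalSpace X] where
  cover : ℕ → Set (Set X)
  isFiniteOpenCover : ∀ n, IsFiniteOpenCover (cover n)
  nonempty : ∀ n, ∀ U ∈ cover n, U.Nonempty
  refines_succ : ∀ n, Refines (· ⊆ ·) (cover (n + 1)) (cover n)
  exists_subset_succ : ∀ n, Refines (· ⊇ ·) (cover n) (cover (n + 1))
  cofinal : ∀ 𝒰, IsFiniteOpenCover 𝒰 → ∃ n, Refines (· ⊆ ·) (cover n) 𝒰

theorem nonempty_coverSeq (X : Type u) [TopologicalSpace X] [CompactSpace X]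
    [SecondCountableTopology X] : Nonempty (CoverSeq X) := by
  obtain ⟨𝒲, h𝒲, hcofinal⟩ := exists_seq_isFiniteOpenCover_cofinal X
  let cover : ℕ → Set (Set X) := Nat.rec (commonRefinement (𝒲 0) (𝒲 0))
    fun n 𝒰 => commonRefinement 𝒰 (𝒲 (n + 1))
  have hcover : ∀ n, ∃ 𝒰, IsFiniteOpenCover 𝒰 ∧ cover n = commonRefinement 𝒰 (𝒲 n) := by
    intro n
    induction n with
    | zero => exact ⟨𝒲 0, h𝒲 0, rfl⟩
    | succ n ih =>
      obtain ⟨𝒰, h𝒰, h⟩ := ih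
      exact ⟨cover n, h ▸ h𝒰.commonRefinement (h𝒲 n), rfl⟩
  have hne : ∀ n, ∀ U ∈ cover n, U.Nonempty := by
    intro n U hU
    obtain ⟨𝒰, -, h⟩ := hcover n
    exact (h ▸ hU : U ∈ commonRefinement 𝒰 (𝒲 n)).2
  exact ⟨{
    cover
    isFiniteOpenCover n := by
      obtain ⟨𝒰, h𝒰, h⟩ := hcover n
      exact h ▸ h𝒰.commonRefinement (h𝒲 n)
    nonempty := hne
    refines_succ _ := commonRefinement_refines_left
    exists_subset_succ n := refines_commonRefinement (hne n) (h𝒲 (n + 1))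
    cofinal 𝒰 h𝒰 := by
      obtain ⟨n, hn⟩ := hcofinal 𝒰 h𝒰
      obtain ⟨𝒱, -, h⟩ := hcover n
      exact ⟨n, h ▸ commonRefinement_refines_right.trans hn⟩ }⟩

namespace CoverSeq

section Level

variable (𝒞 : CoverSeq X) {m n : ℕ}

theorem refines_of_le (h : m ≤ n) : Refines (· ⊆ ·) (𝒞.cover n) (𝒞.cover m) := by
  induction n, h using Nat.le_induction with
  | base => exact Refines.refl _
  | succ n _ ih => exact (𝒞.refines_succ n).trans ih

theorem exists_subset_of_le (h : m ≤ n) : Refines (· ⊇ ·) (𝒞.cover m) (𝒞.cover n) := by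
  induction n, h using Nat.le_induction with
  | base => exact Refines.refl _
  | succ n _ ih => exact ih.trans (𝒞.exists_subset_succ n)

theorem exists_gt_refines (h𝒰 : IsFiniteOpenCover 𝒰) (m : ℕ) :
    ∃ n > m, Refines (· ⊆ ·) (𝒞.cover n) 𝒰 := by
  obtain ⟨k, hk⟩ := 𝒞.cofinal 𝒰 h𝒰
  exact ⟨max k (m + 1), Nat.lt_of_succ_le (le_max_right _ _),
    (𝒞.refines_of_le (le_max_left _ _)).trans hk⟩

end Level

/-- The elements of the poset of a sequence of covers: the members of the covers, tagged with the
index of the cover they are taken from. -/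
structure Elt (𝒞 : CoverSeq X) : Type u where
  level : ℕ
  set : Set X
  mem_cover : set ∈ 𝒞.cover level

variable {𝒞 : CoverSeq X}

/-- Inclusion of sets, with the level required to increase strictly. The second condition makes the
principal filters finite even if a set occurs in infinitely many covers. -/
instance : PartialOrder 𝒞.Elt where
  le p q := p = q ∨ q.level < p.level ∧ p.set ⊆ q.set
  le_refl p := Or.inl rfl
  le_trans := by
    rintro p q r (rfl | ⟨hpq, hpq'⟩) (rfl | ⟨hqr, hqr'⟩)
    · exact Or.inl rfl
    · exact Or.inr ⟨hqr, hqr'⟩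
    · exact Or.inr ⟨hpq, hpq'⟩
    · exact Or.inr ⟨hqr.trans hpq, hpq'.trans hqr'⟩
  le_antisymm := by
    rintro p q (h | h) (h' | h')
    · exact h
    · exact h
    · exact h'.symm
    · exact absurd h.1 h'.1.asymm

namespace Elt

variable {p q : 𝒞.Elt} {n : ℕ}

theorem isOpen (p : 𝒞.Elt) : IsOpen p.set :=
  (𝒞.isFiniteOpenCover _).isOpen _ p.mem_cover

theorem nonempty (p : 𝒞.Elt) : p.set.Nonempty :=
  𝒞.nonempty _ _ p.mem_cover

theorem le_of_subset (hlevel : q.level < p.level) (hset : p.set ⊆ q.set) : p ≤ q :=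
  Or.inr ⟨hlevel, hset⟩

theorem set_subset (h : p ≤ q) : p.set ⊆ q.set :=
  h.elim (fun hpq => hpq ▸ subset_rfl) And.right

theorem level_le (h : p ≤ q) : q.level ≤ p.level :=
  h.elim (fun hpq => hpq ▸ le_rfl) fun hlt => hlt.1.le

theorem finite_setOf_level_le (𝒞 : CoverSeq X) (n : ℕ) : {p : 𝒞.Elt | p.level ≤ n}.Finite := by
  have hfin : (⋃ k ∈ Set.Iic n, Prod.mk k '' 𝒞.cover k).Finite :=
    (Set.finite_Iic n).biUnion fun k _ => (𝒞.isFiniteOpenCover k).finite.image _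
  have hinj : Function.Injective fun p : 𝒞.Elt => (p.level, p.set) := by
    rintro ⟨_, _, _⟩ ⟨_, _, _⟩ ⟨⟩
    rfl
  exact (hfin.preimage hinj.injOn).subset fun p hp =>
    Set.mem_biUnion hp (Set.mem_image_of_mem _ p.mem_cover)

theorem exists_ge (p : 𝒞.Elt) (h : n ≤ p.level) : ∃ q : 𝒞.Elt, q.level = n ∧ p ≤ q := by
  obtain rfl | hlt := h.eq_or_lt
  · exact ⟨p, rfl, le_rfl⟩
  · obtain ⟨U, hU, hpU⟩ := 𝒞.refines_of_le h p.set p.mem_cover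
    exact ⟨⟨n, U, hU⟩, rfl, le_of_subset hlt hpU⟩

theorem exists_le (p : 𝒞.Elt) (h : p.level ≤ n) : ∃ q : 𝒞.Elt, q.level = n ∧ q ≤ p := by
  obtain rfl | hlt := h.eq_or_lt
  · exact ⟨p, rfl, le_rfl⟩
  · obtain ⟨U, hU, hUp⟩ := 𝒞.exists_subset_of_le h p.set p.mem_cover
    exact ⟨⟨n, U, hU⟩, rfl, le_of_subset hlt hUp⟩

theorem isBand_level (𝒞 : CoverSeq X) (n : ℕ) : IsBand {p : 𝒞.Elt | p.level = n} := by
  refine ⟨(finite_setOf_level_le 𝒞 n).subset fun p => le_of_eq, fun p => ?_⟩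
  rcases le_total n p.level with h | h
  · obtain ⟨q, hq, hpq⟩ := p.exists_ge h
    exact ⟨q, hq, Or.inr hpq⟩
  · obtain ⟨q, hq, hqp⟩ := p.exists_le h
    exact ⟨q, hq, Or.inl hqp⟩

theorem isOmegaPoset (𝒞 : CoverSeq X) : IsOmegaPoset 𝒞.Elt := by
  have hfin : ∀ p : 𝒞.Elt, (Set.Ici p).Finite := fun p =>
    (finite_setOf_level_le 𝒞 p.level).subset fun q hq => level_le hq
  refine ⟨hfin, fun n => (finite_setOf_level_le 𝒞 n).subset ?_⟩
  rintro p rfl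
  have hlevels : Set.Iio p.level ⊆ level '' Set.Ici p := fun k hk => by
    obtain ⟨q, hq, hpq⟩ := p.exists_ge (le_of_lt hk)
    exact ⟨q, hpq, hq⟩
  calc p.level = (Set.Iio p.level).ncard := by simp
    _ ≤ (level '' Set.Ici p).ncard := Set.ncard_le_ncard hlevels ((hfin p).image _)
    _ ≤ (Set.Ici p).ncard := Set.ncard_image_le (hfin p)

theorem isTopologicalBasis_range_set [T1Space X] (𝒞 : CoverSeq X) :
    TopologicalSpace.IsTopologicalBasis (Set.range (set : 𝒞.Elt → Set X)) := by
  refine TopologicalSpace.isTopologicalBasis_of_isOpen_of_nhds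
    (Set.forall_mem_range.2 isOpen) fun x U hx hU => ?_
  obtain ⟨n, hn⟩ := 𝒞.cofinal _ (isFiniteOpenCover_pair_compl_singleton hU hx)
  obtain ⟨V, hV, hxV⟩ := (𝒞.isFiniteOpenCover n).exists_mem x
  obtain ⟨W, rfl | rfl, hVW⟩ := hn V hV
  · exact ⟨V, ⟨⟨n, V, hV⟩, rfl⟩, hxV, hVW⟩
  · exact absurd rfl (hVW hxV)

end Elt

open Elt

theorem exists_mem_set_of_isCap {C : Set 𝒞.Elt} (hC : IsCap C) (x : X) :
    ∃ c ∈ C, x ∈ c.set := by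
  obtain ⟨B, ⟨hfin, hB⟩, hBC⟩ := hC
  obtain ⟨n, hn⟩ := (hfin.image level).bddAbove
  obtain ⟨U, hU, hx⟩ := (𝒞.isFiniteOpenCover (n + 1)).exists_mem x
  obtain ⟨b, hb, hbU⟩ := hB ⟨n + 1, U, hU⟩
  have hlevel : b.level < n + 1 := Nat.lt_succ_of_le (hn (Set.mem_image_of_mem level hb))
  obtain ⟨c, hc, hbc⟩ := hBC b hb
  exact ⟨c, hc, set_subset hbc
    (set_subset (hbU.resolve_left fun hle => (level_le hle).not_gt hlevel) hx)⟩

theorem isCap_iff [CompactSpace X] {C : Set 𝒞.Elt} : IsCap C ↔ ∀ x, ∃ c ∈ C, x ∈ c.set := by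
  refine ⟨exists_mem_set_of_isCap, fun hcov => ?_⟩
  obtain ⟨D, hDC, hfin, hD⟩ := exists_isFiniteOpenCover_image (fun c _ => c.isOpen) hcov
  obtain ⟨m, hm⟩ := (hfin.image level).bddAbove
  obtain ⟨n, hmn, hn⟩ := 𝒞.exists_gt_refines hD m
  refine (isBand_level 𝒞 n).isCap.of_refines ?_
  rintro p rfl
  obtain ⟨_, ⟨d, hd, rfl⟩, hpd⟩ := hn p.set p.mem_cover
  exact ⟨d, hDC hd, le_of_subset ((hm (Set.mem_image_of_mem level hd)).trans_lt hmn) hpd⟩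

theorem starBelow_of_closure_subset [CompactSpace X] [T1Space X] {p q : 𝒞.Elt}
    (h : closure p.set ⊆ q.set) : StarBelow p q := by
  refine ⟨{e | e ≤ q ∨ Disjoint p.set e.set}, isCap_iff.2 fun x => ?_, ?_⟩
  · by_cases hx : x ∈ q.set
    · exact ⟨q, Or.inl le_rfl, hx⟩
    · obtain ⟨_, ⟨e, rfl⟩, hxe, he⟩ := (isTopologicalBasis_range_set 𝒞).exists_subset_of_mem_open
        (Set.notMem_subset h hx) isClosed_closure.isOpen_compl
      exact ⟨e, Or.inr ((Set.subset_compl_iff_disjoint_left.1 he).mono_left subset_closure), hxe⟩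
  · rintro e ⟨he | he, r, hrp, hre⟩
    · exact he
    · obtain ⟨x, hx⟩ := r.nonempty
      exact absurd (set_subset hre hx) (Set.disjoint_left.1 he (set_subset hrp hx))

theorem isRegularPoset_elt [CompactSpace X] [T2Space X] (𝒞 : CoverSeq X) :
    IsRegularPoset 𝒞.Elt := by
  intro C hC
  refine ⟨{p | ∃ c ∈ C, StarBelow p c}, isCap_iff.2 fun x => ?_, fun p hp => hp⟩
  obtain ⟨c, hc, hx⟩ := isCap_iff.1 hC x
  obtain ⟨_, ⟨p, rfl⟩, hxp, hpc⟩ := (isTopologicalBasis_range_set 𝒞).exists_closure_subset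
    (c.isOpen.mem_nhds hx)
  exact ⟨p, ⟨c, hc, starBelow_of_closure_subset hpc⟩, hxp⟩

theorem minimal_setOf_mem_set [CompactSpace X] [T1Space X] (𝒞 : CoverSeq X) (x : X) :
    Minimal IsSelector {p : 𝒞.Elt | x ∈ p.set} := by
  refine ⟨fun C hC => ?_, fun T hT hTx p hp => ?_⟩
  · obtain ⟨c, hc, hx⟩ := isCap_iff.1 hC x
    exact ⟨c, hx, hc⟩
  · have hcap : IsCap (insert p {q : 𝒞.Elt | x ∉ q.set}) := by
      refine isCap_iff.2 fun y => ?_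
      by_cases hyx : y = x
      · exact ⟨p, Set.mem_insert _ _, hyx ▸ hp⟩
      · obtain ⟨_, ⟨q, rfl⟩, hyq, hq⟩ :=
          (isTopologicalBasis_range_set 𝒞).exists_subset_of_mem_open
            (Set.mem_compl_singleton_iff.2 hyx) isOpen_compl_singleton
        exact ⟨q, Or.inr fun hxq => hq hxq rfl, hyq⟩
    obtain ⟨q, hqT, rfl | hq⟩ := hT _ hcap
    · exact hqT
    · exact absurd (hTx hqT) hq

/-- The point of the spectrum that corresponds to a point of the space: the minimal selector of all
elements whose set contains it. -/
def toSpectrum [CompactSpace X] [T1Space X] (𝒞 : CoverSeq X) (x : X) : Spectrum 𝒞.Elt :=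
  ⟨{p | x ∈ p.set}, minimal_setOf_mem_set 𝒞 x⟩

theorem continuous_toSpectrum [CompactSpace X] [T1Space X] (𝒞 : CoverSeq X) :
    Continuous 𝒞.toSpectrum :=
  continuous_generateFrom_iff.2 <| Set.forall_mem_range.2 isOpen

theorem injective_toSpectrum [CompactSpace X] [T1Space X] (𝒞 : CoverSeq X) :
    Function.Injective 𝒞.toSpectrum := by
  intro x y hxy
  by_contra hne
  obtain ⟨_, ⟨p, rfl⟩, hxp, hp⟩ := (isTopologicalBasis_range_set 𝒞).exists_subset_of_mem_open
    (Set.mem_compl_singleton_iff.2 hne) isOpen_compl_singleton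
  have hyp : p ∈ (𝒞.toSpectrum y).1 := hxy ▸ hxp
  exact hp hyp rfl

/-- The sets of the elements outside a minimal selector do not cover `X`, and a point they miss is
mapped to that selector. -/
theorem surjective_toSpectrum [CompactSpace X] [T1Space X] (𝒞 : CoverSeq X) :
    Function.Surjective 𝒞.toSpectrum := by
  intro S
  have hcompl := isSelector_iff_not_isCap_compl.1 S.2.prop
  rw [isCap_iff] at hcompl
  push Not at hcompl
  obtain ⟨x, hx⟩ := hcompl
  exact ⟨x, Spectrum.eq_of_subset fun p hxp => by_contra fun hp => hx p hp hxp⟩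

/-- The regular prime `ω`-poset of a sequence of covers. -/
def toPCat [CompactSpace X] [T2Space X] (𝒞 : CoverSeq X) : PCat.{u} where
  carrier := 𝒞.Elt
  omega := isOmegaPoset 𝒞
  regular := isRegularPoset_elt 𝒞
  prime p :=
    let ⟨x, hx⟩ := p.nonempty
    ⟨𝒞.toSpectrum x, hx⟩

theorem nonempty_spectrum_homeomorph [CompactSpace X] [T2Space X] (𝒞 : CoverSeq X) :
    Nonempty (Spectrum 𝒞.toPCat ≃ₜ X) := by
  have : T2Space (Spectrum 𝒞.Elt) := t2Space_spectrum (isOmegaPoset 𝒞) (isRegularPoset_elt 𝒞)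
  let e : X ≃ Spectrum 𝒞.Elt :=
    Equiv.ofBijective 𝒞.toSpectrum ⟨𝒞.injective_toSpectrum, 𝒞.surjective_toSpectrum⟩
  have he : Continuous e := 𝒞.continuous_toSpectrum
  exact ⟨he.homeoOfEquivCompactToT2.symm⟩

end CoverSeq

theorem exists_spectrum_homeomorph (X : Type u) [TopologicalSpace X] [CompactSpace X] [T2Space X]
    [SecondCountableTopology X] : ∃ P : PCat.{u}, Nonempty (Spectrum P ≃ₜ X) :=
  let ⟨𝒞⟩ := nonempty_coverSeq X
  ⟨𝒞.toPCat, 𝒞.nonempty_spectrum_homeomorph⟩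

end Cover

end PosetSpectrum

theorem mainTheorem2 :
    ∃ (hobj : ∀ P : PosetSpectrum.PCat.{u},
        CompactSpace (PosetSpectrum.Spectrum P) ∧
          TopologicalSpace.MetrizableSpace (PosetSpectrum.Spectrum P))
      (hsel : ∀ (P Q : PosetSpectrum.PCat.{u}) (f : P ⟶ Q) (S : PosetSpectrum.Spectrum P),
        Minimal PosetSpectrum.IsSelector (PosetSpectrum.starImage f.rel S.1))
      (hcont : ∀ (P Q : PosetSpectrum.PCat.{u}) (f : P ⟶ Q),
        Continuous (PosetSpectrum.spectrumMap f (hsel P Q f)))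
      (hid : ∀ (P : PosetSpectrum.PCat.{u}) (S : PosetSpectrum.Spectrum P),
        PosetSpectrum.spectrumMap (𝟙 P) (hsel P P (𝟙 P)) S = S)
      (hcomp : ∀ (P Q R : PosetSpectrum.PCat.{u}) (f : P ⟶ Q) (g : Q ⟶ R)
        (S : PosetSpectrum.Spectrum P),
        PosetSpectrum.spectrumMap (f ≫ g) (hsel P R (f ≫ g)) S =
          PosetSpectrum.spectrumMap g (hsel Q R g)
            (PosetSpectrum.spectrumMap f (hsel P Q f) S)),
      (PosetSpectrum.spectrumFunctor hobj hsel hcont hid hcomp).Full ∧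
        (PosetSpectrum.spectrumFunctor hobj hsel hcont hid hcomp).EssSurj := by
  refine ⟨fun P => ⟨inferInstance, PosetSpectrum.metrizableSpace_spectrum P.omega P.regular⟩,
    fun _ _ f => f.minimal_starImage, fun _ _ => PosetSpectrum.continuous_spectrumMap,
    fun _ => PosetSpectrum.spectrumMap_id, fun _ _ _ => PosetSpectrum.spectrumMap_comp,
    ⟨fun {P Q} g => ?_⟩, ⟨fun X => ?_⟩⟩
  · let φ : C(PosetSpectrum.Spectrum P, PosetSpectrum.Spectrum Q) :=
      ConcreteCategory.hom (C := PosetSpectrum.KCat.{u}) g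
    refine ⟨PosetSpectrum.homOfContinuous φ, ?_⟩
    ext S
    exact PosetSpectrum.spectrumMap_homOfContinuous φ S
  · have : TopologicalSpace.MetrizableSpace X := X.prop
    let := TopologicalSpace.metrizableSpaceMetric X
    obtain ⟨P, ⟨e⟩⟩ := PosetSpectrum.exists_spectrum_homeomorph X
    exact ⟨P, ⟨CompHausLike.isoOfHomeo e⟩⟩
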